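/- Let $A$ be a (complex, not necessarily unital) $C^*$-algebra of real rank zero; that is, every self-adjoint element of $A$ (of the unitization of $A$, if $A$ is not unital) is a norm limit of invertible self-adjoint elements. Let $E$ and $F$ be (right) Hilbert $A$-modules, and suppose that $E$ is full, i.e. the linear span of $\{\langle x,y\rangle : x,y\in E\}$ is norm dense in $A$. Let $\theta: E\to F$ be a $\mathbb{C}$-linear $A$-module map, i.e. $\theta(xa)=\theta(x)a$ for all $x\in E$, $a\in A$, which is not assumed to be bounded and which preserves orthogonality: for all $x,y\in E$, $\langle x,y\rangle=0$ implies $\langle\theta(x),\theta(y)\rangle=0$. Then there is a positive element $u$ of the center $Z(M(A))$ of the multiplier algebra $M(A)$ such that $$\langle\theta(x),\theta(y)\rangle = u\,\langle x,y\rangle\qquad (x,y\in E).$$ In particular, $\theta$ is automatically bounded. -/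

import Mathlib

open scoped MultiplierAlgebra RightActions

section HilbertModules

variable {A E : Type*} [NonUnitalCStarAlgebra A] [PartialOrder A] [AddCommGroup E] [Module ℂ E]
  [SMul Aᵐᵒᵖ E] [Norm E] [CStarModule Aᵐᵒᵖ E]

variable (A) in
/-- The `A`-valued inner product `⟨x, y⟩` of a right pre-Hilbert `A`-module `E`.

Mathlib's class `CStarModule B E` is the left-module version of the notion: it demands
`⟨x, b • y⟩ = b * ⟨x, y⟩`. A right `A`-module is a left module over the opposite algebra `Aᵐᵒᵖ`
(with `y <• a = MulOpposite.op a • y`), so a right Hilbert `A`-module is `CStarModule Aᵐᵒᵖ E`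
together with completeness of `E`; reading the inner product in `A` by means of `unop` gives the
usual axioms, which are recorded in the lemmas below. -/
def rightInner (x y : E) : A := MulOpposite.unop (inner Aᵐᵒᵖ x y)

lemma rightInner_smul_right (x y : E) (a : A) :
    rightInner A x (y <• a) = rightInner A x y * a := by
  simp [rightInner]

lemma rightInner_add_right (x y z : E) :
    rightInner A x (y + z) = rightInner A x y + rightInner A x z := by
  simp [rightInner]

lemma rightInner_smul_right_complex (c : ℂ) (x y : E) :
    rightInner A x (c • y) = c • rightInner A x y := by
  simp [rightInner]

lemma star_rightInner (x y : E) : star (rightInner A x y) = rightInner A y x := by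
  rw [rightInner, rightInner, ← CStarModule.star_inner x y, MulOpposite.unop_star]

lemma rightInner_self_nonneg (x : E) : 0 ≤ rightInner A x x :=
  CStarModule.inner_self_nonneg (A := Aᵐᵒᵖ) (x := x)

lemma rightInner_self_eq_zero (x : E) : rightInner A x x = 0 ↔ x = 0 := by
  rw [← CStarModule.inner_self (A := Aᵐᵒᵖ) (x := x), rightInner, MulOpposite.unop_eq_zero_iff]

lemma norm_eq_sqrt_norm_rightInner_self (x : E) : ‖x‖ = √‖rightInner A x x‖ := by
  rw [CStarModule.norm_eq_sqrt_norm_inner_self (A := Aᵐᵒᵖ) x, rightInner, MulOpposite.norm_unop]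

variable (A E) in
/-- `E` is full: the linear span of all inner products is dense in `A`. -/
def IsFullHilbertModule : Prop :=
  Dense (Submodule.span ℂ {a : A | ∃ x y : E, rightInner A x y = a} : Set A)

end HilbertModules

/-- Real rank zero: the invertible self-adjoint elements are norm dense among the self-adjoint
elements. For a non-unital algebra this is, by definition, required of the algebra with a unit
adjoined. The definition adjoins a unit in every case; when `A` already is unital this changes
nothing, since then the unitization is the direct sum of `A` and `ℂ`. -/
def HasRealRankZero (A : Type*) [NonUnitalCStarAlgebra A] : Prop :=
  ∀ a : Unitization ℂ A, IsSelfAdjoint a →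
    ∀ ε : ℝ, 0 < ε → ∃ b : Unitization ℂ A, IsSelfAdjoint b ∧ IsUnit b ∧ ‖a - b‖ < ε

/-- `u ∈ Z(M(A))₊`: the multiplier `u` is central and is positive in the C⋆-algebra `M(A)`. -/
def IsCentralPositiveMultiplier {A : Type*} [NonUnitalCStarAlgebra A] (u : 𝓜(ℂ, A)) : Prop :=
  u ∈ Set.center 𝓜(ℂ, A) ∧ ∃ v : 𝓜(ℂ, A), u = star v * v

/-!
Write `T(x, y) = ⟨θ x, θ y⟩`. The whole argument rests on vectors `x` for which `p = ⟨x, x⟩` is a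
projection. Such a vector splits `E` orthogonally, `y = x⟨x, y⟩ + (y - x⟨x, y⟩)`, so preservation of
orthogonality gives `T(x, y) = h⟨x, y⟩` with `h = T(x, x)`, without any continuity of `θ`. Real rank
zero provides enough of these vectors: for `0 ≤ a` and `ε > 0`, take the positive spectral
projection `p` of an invertible self-adjoint element close to `a - ε`; then `p a p` is bounded below
on `p`, while `(1 - p) a (1 - p)` is small (`HasRealRankZero.exists_projection`). With `a = ⟨z, z⟩`
this approximates `z` by `x b` with `x` as above (`HasRealRankZero.exists_near`).

For such an `x` the element `h` is central in `p A p`: if `c` is self-adjoint in `p A p` and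
`f g = 0`, then `x f(c)` and `x g(c)` are orthogonal, hence `f(c) h g(c) = 0`, and this forces `c` and
`h` to commute (`commute_of_disjoint`, by a partition of unity). If `z`, `w` are orthogonal to `x`, the
orthogonal pair `x⟨w, z⟩ + z`, `x - w p` gives `⟨z, w⟩ h = T(z, w) p`; together with the centrality
of `h` this extends to all `z`, `w` (`rightInner_mul_map_self`). It follows that
`T(z, w)⟨y, x⟩ = ⟨z, w⟩ T(y, x)`, first for these `x`. The identity makes the graph of `θ` closed,
so `θ` is bounded (`IsOrthogonalityPreserving.continuous`), and by density it holds for all `x`.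

The identity says that `⟨x, y⟩ ↦ T(x, y)` is a well-defined bimodule map, and boundedness of `θ`
makes it bounded for the norm of `A` (`norm_snd_le`), because on a full module right multiplication
by `a` has norm `‖a‖`. Its extension to `A` is a central multiplier `u`. Finally `|u|⟨x, x⟩` and
`u⟨x, x⟩ = T(x, x)` are positive with the same square, so `|u| = u`.
-/

open Filter Topology

/-! ### Projections in algebras of real rank zero -/

section Projections

variable {C : Type*} [CStarAlgebra C] [PartialOrder C] [StarOrderedRing C]

/-- The spectral projection of `b` for the positive half-line; since `0` is not in the spectrum of
`b`, the indicator function is continuous there. -/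
lemma exists_projection_of_isUnit {b : C} (hb : IsSelfAdjoint b) (hu : IsUnit b) :
    ∃ p : C, IsSelfAdjoint p ∧ p * p = p ∧ 0 ≤ p * b * p ∧ (1 - p) * b * (1 - p) ≤ 0 := by
  have h0 : ∀ t ∈ spectrum ℝ b, t ≠ 0 := fun t ht h =>
    (spectrum.zero_notMem_iff ℝ).2 hu (h ▸ ht)
  -- away from `0` this is the indicator function of the positive half-line
  let f : ℝ → ℝ := fun t => (1 + t * |t|⁻¹) / 2
  have hf : ContinuousOn f (spectrum ℝ b) := by
    have : ContinuousOn (fun t : ℝ => |t|⁻¹) (spectrum ℝ b) :=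
      (continuous_abs.continuousOn).inv₀ fun t ht => abs_ne_zero.2 (h0 t ht)
    unfold f
    fun_prop
  have hfv : ∀ t ∈ spectrum ℝ b, (0 < t ∧ f t = 1) ∨ (t < 0 ∧ f t = 0) := by
    intro t ht
    rcases lt_or_gt_of_ne (h0 t ht) with h | h
    · right
      refine ⟨h, ?_⟩
      simp [f, abs_of_neg h, inv_neg, mul_inv_cancel₀ h.ne]
    · left
      refine ⟨h, ?_⟩
      simp [f, abs_of_pos h, mul_inv_cancel₀ h.ne']
  have hsub : 1 - cfc f b = cfc (fun t => 1 - f t) b := by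
    rw [cfc_sub (fun _ => (1 : ℝ)) f b, cfc_const_one ℝ b]
  refine ⟨cfc f b, cfc_predicate f b, ?_, ?_, ?_⟩
  · rw [← cfc_mul f f b]
    refine cfc_congr fun t ht => ?_
    rcases hfv t ht with ⟨_, h⟩ | ⟨_, h⟩ <;> simp [h]
  · have : cfc f b * b * cfc f b = cfc (fun t => f t * t * f t) b := by
      rw [cfc_mul (fun t => f t * t) f b, cfc_mul f (fun t => t) b, cfc_id' ℝ b]
    rw [this]
    refine cfc_nonneg fun t ht => ?_
    rcases hfv t ht with ⟨h1, h⟩ | ⟨h1, h⟩ <;> simp [h, h1.le]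
  · have : (1 - cfc f b) * b * (1 - cfc f b) = cfc (fun t => (1 - f t) * t * (1 - f t)) b := by
      rw [hsub, cfc_mul (fun t => (1 - f t) * t) (fun t => 1 - f t) b,
        cfc_mul (fun t => 1 - f t) (fun t => t) b, cfc_id' ℝ b]
    rw [this]
    refine cfc_nonpos _ _ fun t ht => ?_
    rcases hfv t ht with ⟨h1, h⟩ | ⟨h1, h⟩ <;> simp [h, h1.le]

/-- If `b` is close to `a - 2δ`, then its positive spectral projection cuts `a` into a part bounded
below by `δ` and a part of norm at most `3δ`. -/
lemma exists_projection_of_near {a b : C} {δ : ℝ} (hδ : 0 < δ) (ha : 0 ≤ a)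
    (hb : IsSelfAdjoint b) (hu : IsUnit b) (hab : ‖a - algebraMap ℝ C (2 * δ) - b‖ ≤ δ) :
    ∃ p : C, IsSelfAdjoint p ∧ p * p = p ∧ algebraMap ℝ C δ * p ≤ p * a * p ∧
      ‖(1 - p) * a * (1 - p)‖ ≤ 3 * δ := by
  obtain ⟨p, hp, hpp, h1, h2⟩ := exists_projection_of_isUnit hb hu
  have hq : IsSelfAdjoint (1 - p) := (IsSelfAdjoint.one C).sub hp
  have hqq : (1 - p) * (1 - p) = 1 - p := by simp [mul_sub, sub_mul, hpp]
  have hsa : IsSelfAdjoint (a - algebraMap ℝ C (2 * δ) - b) := by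
    refine (IsSelfAdjoint.sub ha.isSelfAdjoint ?_).sub hb
    exact (IsSelfAdjoint.all (2 * δ)).algebraMap C
  set d := a - algebraMap ℝ C (2 * δ) - b with hd
  have ha' : a = algebraMap ℝ C (2 * δ) + b + d := by rw [hd]; abel
  have hle : d ≤ algebraMap ℝ C δ :=
    (hsa.le_algebraMap_norm_self).trans (algebraMap_mono C hab)
  have hge : -algebraMap ℝ C δ ≤ d :=
    (neg_le_neg (algebraMap_mono C hab)).trans hsa.neg_algebraMap_norm_le_self
  refine ⟨p, hp, hpp, ?_, ?_⟩
  · have h3 := star_left_conjugate_le_conjugate hge p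
    rw [hp.star_eq] at h3
    have e : p * a * p = algebraMap ℝ C (2 * δ) * p + p * b * p + p * d * p := by
      rw [ha', mul_add, mul_add, add_mul, add_mul, ← Algebra.commutes, mul_assoc _ p p, hpp]
    have e2 : p * -algebraMap ℝ C δ * p = - (algebraMap ℝ C δ * p) := by
      rw [mul_neg, neg_mul, ← Algebra.commutes, mul_assoc _ p p, hpp]
    rw [e2] at h3
    rw [e]
    calc algebraMap ℝ C δ * p
        = algebraMap ℝ C (2 * δ) * p + 0 + -(algebraMap ℝ C δ * p) := by
          rw [two_mul, map_add, add_mul]; abel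
      _ ≤ _ := add_le_add (add_le_add le_rfl h1) h3
  · have h3 := star_left_conjugate_le_conjugate hle (1 - p)
    rw [hq.star_eq] at h3
    have e : (1 - p) * a * (1 - p) = algebraMap ℝ C (2 * δ) * (1 - p)
        + (1 - p) * b * (1 - p) + (1 - p) * d * (1 - p) := by
      rw [ha', mul_add, mul_add, add_mul, add_mul, ← Algebra.commutes, mul_assoc _ (1 - p), hqq]
    rw [← Algebra.commutes, mul_assoc _ (1 - p), hqq] at h3
    have h4 : (1 - p) * a * (1 - p) ≤ algebraMap ℝ C (3 * δ) * (1 - p) := by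
      rw [e]
      calc _ ≤ algebraMap ℝ C (2 * δ) * (1 - p) + 0 + algebraMap ℝ C δ * (1 - p) :=
            add_le_add (add_le_add le_rfl h2) h3
        _ = _ := by rw [add_zero, ← add_mul, ← map_add]; ring_nf
    have h5 : 0 ≤ (1 - p) * a * (1 - p) := by
      simpa [hq.star_eq] using star_left_conjugate_nonneg ha (1 - p)
    refine (CStarAlgebra.norm_le_norm_of_nonneg_of_le h5 h4).trans ?_
    rw [← Algebra.smul_def, norm_smul, Real.norm_of_nonneg (by positivity)]
    have : ‖1 - p‖ ≤ 1 := by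
      have h6 : ‖1 - p‖ * ‖1 - p‖ = ‖1 - p‖ := by
        rw [← CStarRing.norm_star_mul_self, hq.star_eq, hqq]
      by_contra! h
      nlinarith
    nlinarith

lemma exists_inv_sqrt {c : C} {m : ℝ} (hm : 0 < m) (hc : IsSelfAdjoint c)
    (hmc : algebraMap ℝ C m ≤ c) :
    ∃ r : C, IsSelfAdjoint r ∧ r * c * r = 1 ∧ ∀ x, Commute c x → Commute r x := by
  have hspec : ∀ t ∈ spectrum ℝ c, 0 < t := fun t ht =>
    hm.trans_le ((algebraMap_le_iff_le_spectrum (a := c)).1 hmc t ht)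
  have hcont : ContinuousOn (fun t : ℝ => (√t)⁻¹) (spectrum ℝ c) :=
    Real.continuous_sqrt.continuousOn.inv₀ fun t ht => (Real.sqrt_pos.2 (hspec t ht)).ne'
  refine ⟨cfc (fun t : ℝ => (√t)⁻¹) c, cfc_predicate _ _, ?_, fun x hx => hx.cfc_real _⟩
  have : cfc (fun t : ℝ => (√t)⁻¹) c * c * cfc (fun t : ℝ => (√t)⁻¹) c
      = cfc (fun t : ℝ => (√t)⁻¹ * t * (√t)⁻¹) c := by
    rw [cfc_mul (fun t : ℝ => (√t)⁻¹ * t) (fun t : ℝ => (√t)⁻¹) c (hcont.mul continuousOn_id) hcont,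
      cfc_mul (fun t : ℝ => (√t)⁻¹) (fun t => t) c hcont continuousOn_id, cfc_id' ℝ c]
  rw [this, ← cfc_const_one ℝ c]
  refine cfc_congr fun t ht => ?_
  have h1 := hspec t ht
  have h2 := Real.sqrt_pos.2 h1
  have h3 := Real.mul_self_sqrt h1.le
  field_simp
  rw [pow_two, h3]

/-- An inverse square root of `p a p` in the corner of the projection `p`, obtained from that of
the invertible element `p a p + (1 - p)`. -/
lemma exists_normalizer {p a : C} {δ : ℝ} (hδ : 0 < δ) (ha : 0 ≤ a) (hp : IsSelfAdjoint p)
    (hpp : p * p = p) (h : algebraMap ℝ C δ * p ≤ p * a * p) :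
    ∃ r : C, IsSelfAdjoint r ∧ Commute r p ∧ Commute r (p * a * p) ∧ r * (p * a * p) * r = p := by
  have hq : IsSelfAdjoint (1 - p) := (IsSelfAdjoint.one C).sub hp
  have hqq : (1 - p) * (1 - p) = 1 - p := by simp [mul_sub, sub_mul, hpp]
  have hq0 : 0 ≤ 1 - p := by
    have := star_mul_self_nonneg (1 - p)
    rwa [hq.star_eq, hqq] at this
  have hp0 : 0 ≤ p := by
    have := star_mul_self_nonneg p
    rwa [hp.star_eq, hpp] at this
  obtain ⟨c, hc⟩ : ∃ c, c = p * a * p + (1 - p) := ⟨_, rfl⟩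
  have hpq : p * (1 - p) = 0 := by simp [mul_sub, hpp]
  have hqp : (1 - p) * p = 0 := by simp [sub_mul, hpp]
  have hpc : p * c = p * a * p := by
    rw [hc, mul_add, hpq, add_zero, ← mul_assoc, ← mul_assoc, hpp]
  have hcp : c * p = p * a * p := by
    rw [hc, add_mul, hqp, add_zero, mul_assoc _ p p, hpp]
  have hpap : IsSelfAdjoint (p * a * p) := by
    simpa [hp.star_eq, mul_assoc] using ha.isSelfAdjoint.conjugate p
  have hmc : algebraMap ℝ C (min δ 1) ≤ c := by
    calc algebraMap ℝ C (min δ 1) = (min δ 1) • p + (min δ 1) • (1 - p) := by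
          rw [← smul_add, add_sub_cancel, Algebra.algebraMap_eq_smul_one]
      _ ≤ δ • p + (1 : ℝ) • (1 - p) := by
          refine add_le_add ?_ ?_
          · exact smul_le_smul_of_nonneg_right (min_le_left _ _) hp0
          · exact smul_le_smul_of_nonneg_right (min_le_right _ _) hq0
      _ ≤ c := by
          rw [one_smul, hc, Algebra.smul_def]
          exact add_le_add h le_rfl
  obtain ⟨r, hr, hrc, hcomm⟩ := exists_inv_sqrt (lt_min hδ one_pos) (hc ▸ hpap.add hq) hmc
  have hrp : Commute r p := hcomm p (hcp.trans hpc.symm)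
  refine ⟨r, hr, hrp, ?_, ?_⟩
  · rw [← hpc]
    exact hrp.mul_right (hcomm c (Commute.refl c))
  · rw [← hcp, mul_assoc, mul_assoc, ← hrp.eq, ← mul_assoc, ← mul_assoc, hrc, one_mul]

end Projections

section RealRankZero

variable {A : Type*} [NonUnitalCStarAlgebra A] [PartialOrder A] [StarOrderedRing A]

/-- In an algebra of real rank zero, every `a ≥ 0` is, up to `ε`, carried by a projection `p` on
which it is invertible: `g` is an inverse square root of `p a p`, and the last inequality says that
`(1 - p) a (1 - p)` is small. -/
lemma HasRealRankZero.exists_projection (hA : HasRealRankZero A) {a : A} (ha : 0 ≤ a) {ε : ℝ}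
    (hε : 0 < ε) :
    ∃ p g h : A, IsSelfAdjoint p ∧ p * p = p ∧ star g * a * g = p ∧ g * h = p ∧
      ‖a - p * a - a * p + p * a * p‖ ≤ ε := by
  have hδ : 0 < ε / 3 := by positivity
  have ha' : 0 ≤ (a : Unitization ℂ A) := Unitization.inr_nonneg_iff.2 ha
  obtain ⟨b, hb, hu, hab⟩ := hA ((a : Unitization ℂ A) - algebraMap ℝ _ (2 * (ε / 3)))
    (ha'.isSelfAdjoint.sub ((IsSelfAdjoint.all (2 * (ε / 3))).algebraMap _)) _ hδ
  obtain ⟨p, hp, hpp, h1, h2⟩ := exists_projection_of_near hδ ha' hb hu hab.le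
  obtain ⟨r, hr, hrp, hrc, h3⟩ := exists_normalizer hδ ha' hp hpp h1
  -- `a` lies in the ideal `A` of its unitization, hence so does `p = r p a p r`
  have hp0 : p.fst = 0 := by
    rw [← h3]
    simp
  obtain ⟨p', rfl⟩ : ∃ p' : A, (p' : Unitization ℂ A) = p :=
    ⟨p.snd, by ext <;> simp [hp0]⟩
  obtain ⟨g, hg⟩ : ∃ g : A, (g : Unitization ℂ A) = p' * r :=
    ⟨(p' * r : Unitization ℂ A).snd, by ext <;> simp⟩
  have hinj := Unitization.inr_injective (R := ℂ) (A := A)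
  have hgs : (star g : A) = (r * p' : Unitization ℂ A) := by
    rw [Unitization.inr_star, hg, star_mul, hr.star_eq, hp.star_eq]
  have hgag : star g * a * g = p' := by
    apply hinj
    rw [Unitization.inr_mul, Unitization.inr_mul, hgs, hg]
    simpa only [mul_assoc] using h3
  refine ⟨p', g, star g * a * p', ?_, ?_, hgag, ?_, ?_⟩
  · exact hinj (by simpa using hp.star_eq)
  · exact hinj (by simpa using hpp)
  · apply hinj
    rw [Unitization.inr_mul, Unitization.inr_mul, Unitization.inr_mul, hgs, hg]
    calc (p' * r * (r * p' * a * p') : Unitization ℂ A)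
        = p' * r * (r * (p' * a * p')) := by simp only [mul_assoc]
      _ = p' * (r * (p' * a * p') * r) := by
          rw [mul_assoc r _ r, ← hrc.eq]; simp only [mul_assoc]
      _ = p' := by rw [h3, hpp]
  · have : ((a - p' * a - a * p' + p' * a * p' : A) : Unitization ℂ A)
        = (1 - p') * a * (1 - p') := by
      simp only [Unitization.inr_add, Unitization.inr_sub, Unitization.inr_mul]
      noncomm_ring
    rw [← Unitization.norm_inr (𝕜 := ℂ), this]
    exact h2.trans (by linarith)

end RealRankZero

/-! ### Elements commuting with a functional calculus -/

section Commutator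

/-- The tent function of height one at the integer `i`, supported on `[i - 1, i + 1]`. The tents
form a partition of unity on the real line. -/
def tent (i : ℤ) (t : ℝ) : ℝ := max 0 (1 - |t - i|)

lemma continuous_tent (i : ℤ) : Continuous (tent i) := by
  unfold tent
  fun_prop

lemma tent_mul_tent {i j : ℤ} (h : 2 ≤ |i - j|) (t : ℝ) : tent i t * tent j t = 0 := by
  have h' : (2 : ℝ) ≤ |(i : ℝ) - j| := by exact_mod_cast h
  have h2 : |(i : ℝ) - j| ≤ |t - i| + |t - j| := by
    rw [abs_sub_comm t i]
    exact abs_sub_le _ _ _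
  rcases le_total 1 |t - i| with h3 | h3
  · simp [tent, h3]
  · have : 1 ≤ |t - j| := by linarith
    simp [tent, this]

/-- The tents interpolate a function on the integers piecewise linearly. -/
lemma sum_mul_tent {m : ℕ} {t : ℝ} (ht : |t| < m) (w : ℤ → ℝ) :
    ∑ i ∈ Finset.Icc (-m : ℤ) m, w i * tent i t
      = w ⌊t⌋ * (1 - Int.fract t) + w (⌊t⌋ + 1) * Int.fract t := by
  have hf := Int.floor_add_fract t
  have h0 := Int.fract_nonneg t
  have h1 := Int.fract_lt_one t
  rw [abs_lt] at ht
  have hm1 : -(m : ℤ) ≤ ⌊t⌋ := Int.le_floor.2 (by push_cast; linarith)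
  have hm2 : ⌊t⌋ < (m : ℤ) := Int.floor_lt.2 (by push_cast; linarith)
  have key : ∑ i ∈ ({⌊t⌋, ⌊t⌋ + 1} : Finset ℤ), w i * tent i t
      = ∑ i ∈ Finset.Icc (-m : ℤ) m, w i * tent i t := by
    refine Finset.sum_subset ?_ ?_
    · intro i hi
      simp only [Finset.mem_insert, Finset.mem_singleton] at hi
      rw [Finset.mem_Icc]
      omega
    · intro i _ hi
      simp only [Finset.mem_insert, Finset.mem_singleton, not_or] at hi
      have : 1 ≤ |t - i| := by
        rcases lt_or_gt_of_ne hi.1 with h | h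
        · have : (i : ℝ) ≤ ⌊t⌋ - 1 := by
            have : i ≤ ⌊t⌋ - 1 := by omega
            exact_mod_cast this
          exact le_trans (by linarith) (le_abs_self _)
        · have : (⌊t⌋ : ℝ) + 2 ≤ i := by
            have : ⌊t⌋ + 2 ≤ i := by omega
            exact_mod_cast this
          exact le_trans (by linarith) (neg_le_abs _)
      simp [tent, this]
  rw [← key, Finset.sum_pair (by omega)]
  have e1 : tent ⌊t⌋ t = 1 - Int.fract t := by
    have : t - ⌊t⌋ = Int.fract t := rfl
    rw [tent, this, abs_of_nonneg h0, max_eq_right (by linarith)]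
  have e2 : tent (⌊t⌋ + 1) t = Int.fract t := by
    have : t - ((⌊t⌋ + 1 : ℤ) : ℝ) = Int.fract t - 1 := by
      push_cast; linarith
    rw [tent, this, abs_of_nonpos (by linarith), max_eq_right (by linarith)]
    ring
  rw [e1, e2]

variable {C : Type*} [CStarAlgebra C]

/-- The bound does not involve `c`, so that applying it to multiples of `c` shows that the
commutator vanishes. With `P i` the tents evaluated at `c`, the commutator is
`∑ (i - j) P i * h * P j`. Only terms with `|i - j| ≤ 1` survive, so the coefficient may be replaced
by `sin ((i - j) π / 2)`, which has rank two by the addition formula. -/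
lemma norm_commutator_le_of_disjoint {c h : C} (hc : IsSelfAdjoint c)
    (H : ∀ f g : ℝ → ℝ, Continuous f → Continuous g → (∀ t, f t * g t = 0) →
      cfc f c * h * cfc g c = 0) : ‖c * h - h * c‖ ≤ 2 * ‖h‖ := by
  obtain ⟨m, hm⟩ := exists_nat_gt (‖c‖ * ‖(1 : C)‖)
  have hspec : ∀ t ∈ spectrum ℝ c, |t| < m := fun t ht =>
    lt_of_le_of_lt (spectrum.norm_le_norm_mul_of_mem ht) hm
  let P : ℤ → C := fun i => cfc (tent i) c
  let s := Finset.Icc (-m : ℤ) m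
  have hsum : ∀ w : ℤ → ℝ, ∑ i ∈ s, w i • P i
      = cfc (fun t => ∑ i ∈ s, w i * tent i t) c := by
    intro w
    have hfun : (fun t => ∑ i ∈ s, w i * tent i t) = ∑ i ∈ s, fun t => w i * tent i t := by
      ext t
      simp
    rw [hfun, cfc_sum (fun i t => w i * tent i t) c s fun i _ =>
      (continuous_const.mul (continuous_tent i)).continuousOn]
    exact Finset.sum_congr rfl fun i _ =>
      (cfc_const_mul (w i) (tent i) c (continuous_tent i).continuousOn).symm
  have hnorm : ∀ w : ℤ → ℝ, (∀ i, |w i| ≤ 1) → ‖∑ i ∈ s, w i • P i‖ ≤ 1 := by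
    intro w hw
    rw [hsum]
    refine norm_cfc_le zero_le_one fun t ht => ?_
    rw [sum_mul_tent (hspec t ht), Real.norm_eq_abs]
    have h0 := Int.fract_nonneg t
    have h1 := Int.fract_lt_one t
    have h2 := abs_le.1 (hw ⌊t⌋)
    have h3 := abs_le.1 (hw (⌊t⌋ + 1))
    rw [abs_le]
    constructor <;> nlinarith
  have hone : ∑ i ∈ s, P i = 1 := by
    have := hsum fun _ => 1
    simp only [one_smul] at this
    rw [this, ← cfc_const_one ℝ c]
    refine cfc_congr fun t ht => ?_
    exact (sum_mul_tent (hspec t ht) _).trans (by ring)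
  have hid : ∑ i ∈ s, (i : ℝ) • P i = c := by
    conv_rhs => rw [← cfc_id' ℝ c]
    rw [hsum]
    refine cfc_congr fun t ht => ?_
    refine (sum_mul_tent (hspec t ht) _).trans ?_
    have hf := Int.floor_add_fract t
    push_cast
    linarith
  have hP : ∀ i j : ℤ, 2 ≤ |i - j| → P i * h * P j = 0 := fun i j hij =>
    H _ _ (continuous_tent i) (continuous_tent j) (tent_mul_tent hij)
  have hbil : ∀ v w : ℤ → ℝ, (∑ i ∈ s, v i • P i) * h * (∑ j ∈ s, w j • P j)
      = ∑ i ∈ s, ∑ j ∈ s, (v i * w j) • (P i * h * P j) := by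
    intro v w
    rw [Finset.sum_mul, Finset.sum_mul_sum]
    simp only [smul_mul_assoc, mul_smul_comm, smul_smul, mul_comm]
  let S : ℤ → ℝ := fun i => Real.sin (i * (Real.pi / 2))
  let K : ℤ → ℝ := fun i => Real.cos (i * (Real.pi / 2))
  have hSK : ∀ i j : ℤ, |i - j| < 2 → (i : ℝ) - j = S i * K j - K i * S j := by
    intro i j hij
    have : S i * K j - K i * S j = Real.sin ((i - j : ℤ) * (Real.pi / 2)) := by
      rw [← Real.sin_sub]
      push_cast
      ring_nf
    rw [this]
    have h2 : i - j = -1 ∨ i - j = 0 ∨ i - j = 1 := by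
      rw [abs_lt] at hij
      omega
    rw [← Int.cast_sub]
    rcases h2 with h2 | h2 | h2 <;> rw [h2] <;> simp
  have hcomm : c * h - h * c = (∑ i ∈ s, S i • P i) * h * (∑ j ∈ s, K j • P j)
      - (∑ i ∈ s, K i • P i) * h * (∑ j ∈ s, S j • P j) := by
    have e1 := hbil (fun i => i) (fun _ => 1)
    have e2 := hbil (fun _ => 1) (fun i => i)
    simp only [one_smul, hone, hid, mul_one, one_mul] at e1 e2
    rw [e1, e2, hbil, hbil, ← Finset.sum_sub_distrib, ← Finset.sum_sub_distrib]
    refine Finset.sum_congr rfl fun i _ => ?_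
    rw [← Finset.sum_sub_distrib, ← Finset.sum_sub_distrib]
    refine Finset.sum_congr rfl fun j _ => ?_
    rw [← sub_smul, ← sub_smul]
    rcases lt_or_ge |i - j| 2 with hij | hij
    · rw [hSK i j hij]
    · rw [hP i j hij, smul_zero, smul_zero]
  have hS := hnorm S fun i => Real.abs_sin_le_one _
  have hK := hnorm K fun i => Real.abs_cos_le_one _
  rw [hcomm]
  have hb : ∀ x y : C, ‖x‖ ≤ 1 → ‖y‖ ≤ 1 → ‖x * h * y‖ ≤ ‖h‖ := by
    intro x y hx hy
    calc ‖x * h * y‖ ≤ ‖x‖ * ‖h‖ * ‖y‖ :=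
          (norm_mul_le _ _).trans (mul_le_mul_of_nonneg_right (norm_mul_le _ _) (norm_nonneg _))
      _ ≤ 1 * ‖h‖ * 1 := by gcongr
      _ = ‖h‖ := by ring
  calc _ ≤ _ := norm_sub_le _ _
    _ ≤ ‖h‖ + ‖h‖ := add_le_add (hb _ _ hS hK) (hb _ _ hK hS)
    _ = _ := by ring

/-- An element `h` with `f(c) h g(c) = 0` for all `f`, `g` of disjoint supports commutes with
`c`. -/
lemma commute_of_disjoint {c h : C} (hc : IsSelfAdjoint c)
    (H : ∀ f g : ℝ → ℝ, Continuous f → Continuous g → (∀ t, f t * g t = 0) →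
      cfc f c * h * cfc g c = 0) : Commute c h := by
  have key : ∀ n : ℕ, n * ‖c * h - h * c‖ ≤ 2 * ‖h‖ := by
    intro n
    have := norm_commutator_le_of_disjoint (c := (n : ℝ) • c) (h := h)
      ((IsSelfAdjoint.all (n : ℝ)).smul hc) ?_
    · rwa [smul_mul_assoc, mul_smul_comm, ← smul_sub, norm_smul, Real.norm_of_nonneg
        (Nat.cast_nonneg n)] at this
    · intro f g hf hg hfg
      rw [← cfc_comp_smul (n : ℝ) f c, ← cfc_comp_smul (n : ℝ) g c]
      exact H _ _ (hf.comp (continuous_const_smul _)) (hg.comp (continuous_const_smul _))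
        fun t => hfg _
  have : ‖c * h - h * c‖ = 0 := by
    by_contra hne
    have hpos : 0 < ‖c * h - h * c‖ := lt_of_le_of_ne (norm_nonneg _) (Ne.symm hne)
    obtain ⟨n, hn⟩ := exists_nat_gt (2 * ‖h‖ / ‖c * h - h * c‖)
    rw [div_lt_iff₀ hpos] at hn
    exact absurd (key n) (not_le.2 hn)
  exact sub_eq_zero.1 (norm_eq_zero.1 this)

end Commutator

/-! ### Hilbert modules and vectors whose square is a projection -/

section RightInner

variable {A E : Type*} [NonUnitalCStarAlgebra A] [PartialOrder A]
  [NormedAddCommGroup E] [NormedSpace ℂ E] [SMul Aᵐᵒᵖ E] [CStarModule Aᵐᵒᵖ E]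

local notation "⟪" x ", " y "⟫" => rightInner A x y

lemma rightInner_add_left (x y z : E) : ⟪x + y, z⟫ = ⟪x, z⟫ + ⟪y, z⟫ := by
  simp [rightInner]

lemma rightInner_sub_left (x y z : E) : ⟪x - y, z⟫ = ⟪x, z⟫ - ⟪y, z⟫ := by
  simp [rightInner]

lemma rightInner_sub_right (x y z : E) : ⟪x, y - z⟫ = ⟪x, y⟫ - ⟪x, z⟫ := by
  simp [rightInner]

lemma rightInner_smul_left (x y : E) (a : A) : ⟪x <• a, y⟫ = star a * ⟪x, y⟫ := by
  simp [rightInner]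

lemma rightInner_smul_left_complex (c : ℂ) (x y : E) : ⟪c • x, y⟫ = star c • ⟪x, y⟫ := by
  simp [rightInner]

variable (A) in
lemma norm_rightInner_le [StarOrderedRing A] (x y : E) : ‖⟪x, y⟫‖ ≤ ‖x‖ * ‖y‖ := by
  rw [rightInner, MulOpposite.norm_unop]
  exact CStarModule.norm_inner_le E

variable (A) in
lemma norm_rightInner_self (x : E) : ‖⟪x, x⟫‖ = ‖x‖ * ‖x‖ := by
  rw [norm_eq_sqrt_norm_rightInner_self (A := A) x, Real.mul_self_sqrt (norm_nonneg _)]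

variable (A) in
@[fun_prop]
lemma continuous_rightInner_left [StarOrderedRing A] (y : E) : Continuous fun x : E => ⟪x, y⟫ :=
  MulOpposite.continuous_unop.comp
    (CStarModule.continuous_inner (A := Aᵐᵒᵖ).comp (continuous_id.prodMk continuous_const))

variable (A) in
@[fun_prop]
lemma continuous_rightInner_right [StarOrderedRing A] (x : E) : Continuous fun y : E => ⟪x, y⟫ :=
  MulOpposite.continuous_unop.comp
    (CStarModule.continuous_inner (A := Aᵐᵒᵖ).comp (continuous_const.prodMk continuous_id))

lemma ext_rightInner {x y : E} (h : ∀ w : E, ⟪w, x⟫ = ⟪w, y⟫) : x = y := by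
  rw [← sub_eq_zero, ← rightInner_self_eq_zero (A := A), rightInner_sub_right, h, sub_self]

lemma rightSMul_mul (x : E) (a b : A) : x <• (a * b) = x <• a <• b :=
  ext_rightInner (A := A) fun w => by simp only [rightInner_smul_right, mul_assoc]

/-- The vector `x` satisfies `⟨x, x⟩² = ⟨x, x⟩`. As `⟨x, x⟩` is self-adjoint, it is a projection
`p`, and `a ↦ x a` is a partial isometry from `A` to `E` with initial space `p A`. -/
def IsPartialIsometryVector (A : Type*) {E : Type*} [NonUnitalCStarAlgebra A] [PartialOrder A]
    [NormedAddCommGroup E] [NormedSpace ℂ E] [SMul Aᵐᵒᵖ E] [CStarModule Aᵐᵒᵖ E] (x : E) : Prop :=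
  IsIdempotentElem (rightInner A x x)

namespace IsPartialIsometryVector

variable {x : E} (hx : IsPartialIsometryVector A x)
include hx

lemma smul_self : x <• ⟪x, x⟫ = x := by
  have h : ⟪x, x⟫ * ⟪x, x⟫ = ⟪x, x⟫ := hx
  rw [← sub_eq_zero, ← rightInner_self_eq_zero (A := A)]
  simp only [rightInner_sub_left, rightInner_sub_right, rightInner_smul_left,
    rightInner_smul_right, star_rightInner, h, sub_self, zero_mul]

lemma self_mul (y : E) : ⟪x, x⟫ * ⟪x, y⟫ = ⟪x, y⟫ := by
  rw [← star_rightInner x x, ← rightInner_smul_left, hx.smul_self]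

lemma mul_self (y : E) : ⟪y, x⟫ * ⟪x, x⟫ = ⟪y, x⟫ := by
  rw [← rightInner_smul_right, hx.smul_self]

lemma rightInner_sub_smul (y : E) : ⟪x, y - x <• ⟪x, y⟫⟫ = 0 := by
  rw [rightInner_sub_right, rightInner_smul_right, hx.self_mul, sub_self]

end IsPartialIsometryVector

/-- Over an algebra of real rank zero, the multiples of partial isometry vectors are dense. -/
lemma HasRealRankZero.exists_near [StarOrderedRing A] (hA : HasRealRankZero A) (z : E)
    {ε : ℝ} (hε : 0 < ε) :
    ∃ (x : E) (b : A), IsPartialIsometryVector A x ∧ ‖z - x <• b‖ ≤ ε := by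
  obtain ⟨p, g, h, hp, hpp, hg, hgh, hn⟩ :=
    hA.exists_projection (rightInner_self_nonneg z) (mul_pos hε hε)
  refine ⟨z <• g, h, ?_, ?_⟩
  · have : ⟪z <• g, z <• g⟫ = p := by
      rw [rightInner_smul_left, rightInner_smul_right, ← hg, mul_assoc]
    rw [IsPartialIsometryVector, this]
    exact hpp
  · rw [← rightSMul_mul (A := A), hgh]
    have e : ⟪z - z <• p, z - z <• p⟫ = ⟪z, z⟫ - p * ⟪z, z⟫ - ⟪z, z⟫ * p + p * ⟪z, z⟫ * p := by
      simp only [rightInner_sub_left, rightInner_sub_right, rightInner_smul_left,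
        rightInner_smul_right, hp.star_eq, sub_mul, mul_assoc]
      abel
    rw [← e, norm_rightInner_self] at hn
    exact (mul_self_le_mul_self_iff (norm_nonneg _) hε.le).2 hn

end RightInner

/-! ### Orthogonality preserving maps on partial isometry vectors -/

/-- `θ` is an `A`-module map which preserves orthogonality; no continuity is required. -/
structure IsOrthogonalityPreserving (A : Type*) {E F : Type*} [NonUnitalCStarAlgebra A]
    [PartialOrder A] [NormedAddCommGroup E] [NormedSpace ℂ E] [SMul Aᵐᵒᵖ E] [CStarModule Aᵐᵒᵖ E]
    [NormedAddCommGroup F] [NormedSpace ℂ F] [SMul Aᵐᵒᵖ F] [CStarModule Aᵐᵒᵖ F]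
    (θ : E →ₗ[ℂ] F) : Prop where
  map_smul : ∀ (x : E) (a : A), θ (x <• a) = θ x <• a
  map_orth : ∀ x y : E, rightInner A x y = 0 → rightInner A (θ x) (θ y) = 0

namespace IsOrthogonalityPreserving

variable {A E F : Type*}
    [NonUnitalCStarAlgebra A] [PartialOrder A]
    [NormedAddCommGroup E] [NormedSpace ℂ E] [SMul Aᵐᵒᵖ E] [CStarModule Aᵐᵒᵖ E]
    [NormedAddCommGroup F] [NormedSpace ℂ F] [SMul Aᵐᵒᵖ F] [CStarModule Aᵐᵒᵖ F]
    {θ : E →ₗ[ℂ] F} (hθ : IsOrthogonalityPreserving A θ)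
include hθ

local notation "⟪" x ", " y "⟫" => rightInner A x y

lemma rightInner_map_smul_right (x y : E) (a : A) :
    ⟪θ x, θ (y <• a)⟫ = ⟪θ x, θ y⟫ * a := by
  rw [hθ.map_smul, rightInner_smul_right]

lemma rightInner_map_smul_left (x y : E) (a : A) :
    ⟪θ (x <• a), θ y⟫ = star a * ⟪θ x, θ y⟫ := by
  rw [hθ.map_smul, rightInner_smul_left]

lemma rightInner_map_right {x : E} (hx : IsPartialIsometryVector A x) (y : E) :
    ⟪θ x, θ y⟫ = ⟪θ x, θ x⟫ * ⟪x, y⟫ := by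
  have h := hθ.map_orth _ _ (hx.rightInner_sub_smul y)
  rwa [map_sub, rightInner_sub_right, hθ.rightInner_map_smul_right, sub_eq_zero] at h

lemma rightInner_map_left {x : E} (hx : IsPartialIsometryVector A x) (y : E) :
    ⟪θ y, θ x⟫ = ⟪y, x⟫ * ⟪θ x, θ x⟫ := by
  rw [← star_rightInner, hθ.rightInner_map_right hx, star_mul, star_rightInner, star_rightInner]

lemma self_mul_map {x : E} (hx : IsPartialIsometryVector A x) :
    ⟪x, x⟫ * ⟪θ x, θ x⟫ = ⟪θ x, θ x⟫ := (hθ.rightInner_map_left hx x).symm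

lemma map_mul_self {x : E} (hx : IsPartialIsometryVector A x) :
    ⟪θ x, θ x⟫ * ⟪x, x⟫ = ⟪θ x, θ x⟫ := (hθ.rightInner_map_right hx x).symm

/-- For `f g = 0` the vectors `x f(c)` and `x g(c)` are orthogonal, and `commute_of_disjoint`
applies. -/
lemma commute_of_isSelfAdjoint [StarOrderedRing A] {x : E}
    (hx : IsPartialIsometryVector A x) {c : A} (hc : IsSelfAdjoint c) (hpc : ⟪x, x⟫ * c = c) :
    c * ⟪θ x, θ x⟫ = ⟪θ x, θ x⟫ * c := by
  obtain ⟨p, hp⟩ : ∃ p, p = ⟪x, x⟫ := ⟨_, rfl⟩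
  obtain ⟨k, hk⟩ : ∃ k, k = ⟪θ x, θ x⟫ := ⟨_, rfl⟩
  have hpp : p * p = p := by rw [hp]; exact hx
  have hps : star p = p := by rw [hp, star_rightInner]
  have hcp : c * p = c := by
    have := congrArg star hpc
    rwa [star_mul, hc.star_eq, ← hp, hps] at this
  rw [← hp] at hpc
  have hpk : p * k = k := by rw [hp, hk, hθ.self_mul_map hx]
  have hkp : k * p = k := by rw [hp, hk, hθ.map_mul_self hx]
  rw [← hk]
  have key : Commute (c : Unitization ℂ A) k := by
    refine commute_of_disjoint (hc.inr ℂ) fun f g hf hg hfg => ?_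
    have hcomm : ∀ f : ℝ → ℝ, Commute (cfc f (c : Unitization ℂ A)) p := fun f => by
      refine Commute.cfc_real ?_ f
      rw [Commute, SemiconjBy, ← Unitization.inr_mul, ← Unitization.inr_mul, hpc, hcp]
    -- `f(c)` lives in the unitization, which does not act on `E`, but `⟨x, x⟩ f(c)` is in `A`
    have hex : ∀ f : ℝ → ℝ, ∃ α : A, (α : Unitization ℂ A) = p * cfc f (c : Unitization ℂ A) :=
      fun f => ⟨(p * cfc f (c : Unitization ℂ A) : Unitization ℂ A).snd, by ext <;> simp⟩
    obtain ⟨α, hα⟩ := hex f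
    obtain ⟨β, hβ⟩ := hex g
    have hp' : (p : Unitization ℂ A) * p = p := by rw [← Unitization.inr_mul, hpp]
    have hαs : ((star α : A) : Unitization ℂ A) = cfc f (c : Unitization ℂ A) * p := by
      rw [Unitization.inr_star, hα, star_mul, ← Unitization.inr_star, hps,
        (cfc_predicate f (c : Unitization ℂ A) : IsSelfAdjoint _).star_eq]
    have hfg' : cfc f (c : Unitization ℂ A) * cfc g (c : Unitization ℂ A) = 0 := by
      rw [← cfc_mul f g _ hf.continuousOn hg.continuousOn]
      simp [hfg]
    have horth : ⟪x <• α, x <• β⟫ = 0 := by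
      rw [rightInner_smul_left, rightInner_smul_right, ← hp]
      apply Unitization.inr_injective (R := ℂ)
      rw [Unitization.inr_mul, Unitization.inr_mul, hαs, hβ, Unitization.inr_zero,
        ← mul_assoc (p : Unitization ℂ A), hp', mul_assoc, ← mul_assoc (p : Unitization ℂ A), hp',
        ← mul_assoc, (hcomm f).eq, mul_assoc, hfg', mul_zero]
    have h2 := hθ.map_orth _ _ horth
    rw [hθ.rightInner_map_smul_left, hθ.rightInner_map_smul_right, ← hk] at h2
    have h3 := congrArg (Unitization.inr (R := ℂ)) h2
    rw [Unitization.inr_mul, Unitization.inr_mul, hαs, hβ, Unitization.inr_zero] at h3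
    have hk' : (k : Unitization ℂ A) = p * k * p := by
      rw [← Unitization.inr_mul, ← Unitization.inr_mul, hpk, hkp]
    rw [hk', ← h3]
    simp only [mul_assoc]
  exact Unitization.inr_injective (R := ℂ) (by simpa using key.eq)

end IsOrthogonalityPreserving

/-! ### Full Hilbert modules -/

section Full

variable {A E : Type*} [NonUnitalCStarAlgebra A] [PartialOrder A]
  [NormedAddCommGroup E] [NormedSpace ℂ E] [SMul Aᵐᵒᵖ E] [CStarModule Aᵐᵒᵖ E]

local notation "⟪" x ", " y "⟫" => rightInner A x y

lemma norm_rightSMul_le (x : E) (a : A) : ‖x <• a‖ ≤ ‖x‖ * ‖a‖ := by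
  refine (mul_self_le_mul_self_iff (norm_nonneg _) (by positivity)).2 ?_
  rw [← norm_rightInner_self A, rightInner_smul_left, rightInner_smul_right]
  calc ‖star a * (⟪x, x⟫ * a)‖ ≤ ‖star a‖ * (‖⟪x, x⟫‖ * ‖a‖) :=
        (norm_mul_le _ _).trans (by gcongr; exact norm_mul_le _ _)
    _ = _ := by rw [norm_star, norm_rightInner_self]; ring

lemma IsFullHilbertModule.eq_of_forall_rightInner (hE : IsFullHilbertModule A E) {B : Type*}
    [NormedAddCommGroup B] [NormedSpace ℂ B] {S T : A →L[ℂ] B}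
    (h : ∀ x y : E, S ⟪x, y⟫ = T ⟪x, y⟫) : S = T := by
  refine ContinuousLinearMap.ext_on hE ?_
  rintro _ ⟨x, y, rfl⟩
  exact h x y

lemma IsFullHilbertModule.eq_zero_of_mul (hE : IsFullHilbertModule A E) {c : A}
    (h : ∀ x y : E, c * ⟪x, y⟫ = 0) : c = 0 := by
  have := hE.eq_of_forall_rightInner (S := ContinuousLinearMap.mul ℂ A c) (T := 0)
    fun x y => by simpa using h x y
  rw [← CStarRing.mul_star_self_eq_zero_iff]
  simpa using congrArg (fun S => S (star c)) this

/-- On a full module, right multiplication by `a` has norm at least `‖a‖`. If it were at most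
`C < ‖a‖`, then `‖k aⁿ‖` would be `O(Cⁿ)` for every `k` in the span of the inner products; taking
`k` close to `a`, this contradicts `‖aⁿ‖ = ‖a‖ⁿ` for `n` a power of two. -/
lemma IsSelfAdjoint.norm_le_of_forall_norm_rightSMul_le [StarOrderedRing A]
    (hE : IsFullHilbertModule A E) {a : A} (ha : IsSelfAdjoint a) {C : ℝ} (hC : 0 ≤ C)
    (h : ∀ x : E, ‖x <• a‖ ≤ C * ‖x‖) : ‖a‖ ≤ C := by
  by_contra! hlt
  have ht : 0 < ‖a‖ := hC.trans_lt hlt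
  -- `b n` is `a ^ (n + 1)`; the algebra `A` need not have a unit
  let b : ℕ → A := fun n => Nat.rec a (fun _ c => c * a) n
  have hb0 : b 0 = a := rfl
  have hbs : ∀ n, b (n + 1) = b n * a := fun n => rfl
  have hbu : ∀ n, (Unitization.inr (b n) : Unitization ℂ A) = (a : Unitization ℂ A) ^ (n + 1) := by
    intro n
    induction n with
    | zero => simp [hb0]
    | succ n ih => rw [hbs, Unitization.inr_mul, ih, pow_succ _ (n + 1)]
  have hbn : ∀ n, ‖b n‖ ≤ ‖a‖ ^ (n + 1) := by
    intro n
    rw [← Unitization.norm_inr (𝕜 := ℂ), hbu, ← Unitization.norm_inr (𝕜 := ℂ) a]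
    exact norm_pow_le _ _
  have hbx : ∀ n (x : E), ‖x <• b n‖ ≤ C ^ (n + 1) * ‖x‖ := by
    intro n x
    induction n with
    | zero => simpa [hb0] using h x
    | succ n ih =>
      rw [hbs, rightSMul_mul (A := A)]
      calc _ ≤ C * ‖x <• b n‖ := h _
        _ ≤ C * (C ^ (n + 1) * ‖x‖) := by gcongr
        _ = _ := by ring
  have hspan : ∀ k ∈ Submodule.span ℂ {a : A | ∃ x y : E, ⟪x, y⟫ = a},
      ∃ K : ℝ, ∀ n, ‖k * b n‖ ≤ K * C ^ (n + 1) := by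
    intro k hk
    induction hk using Submodule.span_induction with
    | mem k hk =>
      obtain ⟨x, y, rfl⟩ := hk
      refine ⟨‖x‖ * ‖y‖, fun n => ?_⟩
      rw [← rightInner_smul_right]
      calc _ ≤ ‖x‖ * ‖y <• b n‖ := norm_rightInner_le A _ _
        _ ≤ ‖x‖ * (C ^ (n + 1) * ‖y‖) := by gcongr; exact hbx n y
        _ = _ := by ring
    | zero => exact ⟨0, fun n => by simp⟩
    | add k l _ _ hk hl =>
      obtain ⟨K, hK⟩ := hk
      obtain ⟨L, hL⟩ := hl
      refine ⟨K + L, fun n => ?_⟩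
      rw [add_mul, add_mul]
      exact (norm_add_le _ _).trans (add_le_add (hK n) (hL n))
    | smul c k _ hk =>
      obtain ⟨K, hK⟩ := hk
      refine ⟨‖c‖ * K, fun n => ?_⟩
      rw [smul_mul_assoc, norm_smul, mul_assoc]
      gcongr
      exact hK n
  obtain ⟨k, hk, hka⟩ := Metric.dense_iff.1 hE a (‖a‖ / 2) (by positivity)
  rw [Metric.mem_ball, dist_comm, dist_eq_norm] at hk
  obtain ⟨K, hK⟩ := hspan k hka
  have hq : C / ‖a‖ < 1 := (div_lt_one ht).2 hlt
  have hq0 : 0 ≤ C / ‖a‖ := by positivity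
  have hlim : Tendsto (fun m : ℕ => K * (C / ‖a‖) ^ (2 ^ (m + 1) - 1)) atTop (𝓝 (K * 0)) := by
    refine ((tendsto_pow_atTop_nhds_zero_of_lt_one hq0 hq).comp ?_).const_mul K
    refine tendsto_atTop_mono (fun m => ?_) tendsto_id
    have := Nat.lt_two_pow_self (n := m + 1)
    simp only [id]
    omega
  rw [mul_zero] at hlim
  have hge : ∀ m : ℕ, ‖a‖ / 2 ≤ K * (C / ‖a‖) ^ (2 ^ (m + 1) - 1) := by
    intro m
    obtain ⟨n, hn⟩ : ∃ n, 2 ^ (m + 1) = n + 2 :=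
      ⟨2 ^ (m + 1) - 2, by have := Nat.lt_two_pow_self (n := m + 1); omega⟩
    have e1 : ‖a * b n‖ = ‖a‖ ^ (n + 2) := by
      rw [← Unitization.norm_inr (𝕜 := ℂ), Unitization.inr_mul, hbu, ← pow_succ', ← hn,
        (ha.inr ℂ).norm_pow_two_pow, Unitization.norm_inr]
    have e2 : ‖a * b n‖ ≤ K * C ^ (n + 1) + ‖a‖ / 2 * ‖a‖ ^ (n + 1) := by
      calc ‖a * b n‖ = ‖k * b n + (a - k) * b n‖ := by rw [← add_mul, add_sub_cancel]
        _ ≤ ‖k * b n‖ + ‖a - k‖ * ‖b n‖ :=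
          (norm_add_le _ _).trans (by gcongr; exact norm_mul_le _ _)
        _ ≤ _ := by
          gcongr
          · exact hK n
          · exact hbn n
    have e3 : 2 ^ (m + 1) - 1 = n + 1 := by omega
    have hp : 0 < ‖a‖ ^ (n + 1) := by positivity
    rw [e3, div_pow, ← mul_div_assoc, le_div_iff₀ hp]
    rw [e1, pow_succ _ (n + 1)] at e2
    nlinarith
  have := ge_of_tendsto' hlim hge
  linarith

lemma IsFullHilbertModule.norm_le_of_forall_norm_rightSMul_le [StarOrderedRing A]
    (hE : IsFullHilbertModule A E) {a : A} {C : ℝ} (hC : 0 ≤ C)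
    (h : ∀ x : E, ‖x <• a‖ ≤ C * ‖x‖) : ‖a‖ ≤ C := by
  have h1 : ‖a * star a‖ ≤ C * ‖a‖ := by
    refine (IsSelfAdjoint.mul_star_self a).norm_le_of_forall_norm_rightSMul_le hE (by positivity)
      fun x => ?_
    rw [rightSMul_mul (A := A)]
    calc _ ≤ ‖x <• a‖ * ‖star a‖ := norm_rightSMul_le _ _
      _ ≤ C * ‖x‖ * ‖a‖ := by rw [norm_star]; gcongr; exact h x
      _ = _ := by ring
  rw [CStarRing.norm_self_mul_star] at h1
  by_contra! hlt
  nlinarith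

/-- A closed property of vectors holds everywhere once it holds for all multiples of partial
isometry vectors. -/
lemma HasRealRankZero.induction [StarOrderedRing A] (hA : HasRealRankZero A) {P : E → Prop}
    (hP : IsClosed {x | P x}) (h : ∀ (x : E) (b : A), IsPartialIsometryVector A x → P (x <• b))
    (z : E) : P z := by
  have hz : z ∈ closure {x | P x} := by
    refine Metric.mem_closure_iff.2 fun ε hε => ?_
    obtain ⟨x, b, hx, hn⟩ := hA.exists_near z (half_pos hε)
    refine ⟨x <• b, h x b hx, ?_⟩
    rw [dist_eq_norm]
    linarith
  rwa [hP.closure_eq] at hz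

end Full

/-! ### Automatic continuity -/

namespace IsOrthogonalityPreserving

variable {A E F : Type*} [NonUnitalCStarAlgebra A] [PartialOrder A] [StarOrderedRing A]
    [NormedAddCommGroup E] [NormedSpace ℂ E] [SMul Aᵐᵒᵖ E] [CStarModule Aᵐᵒᵖ E]
    [NormedAddCommGroup F] [NormedSpace ℂ F] [SMul Aᵐᵒᵖ F] [CStarModule Aᵐᵒᵖ F]
    {θ : E →ₗ[ℂ] F} (hθ : IsOrthogonalityPreserving A θ)
include hθ

local notation "⟪" x ", " y "⟫" => rightInner A x y

/-- `⟨θ x, θ x⟩` is central in the corner of the projection `⟨x, x⟩`. -/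
lemma self_mul_mul_map {x : E} (hx : IsPartialIsometryVector A x) (b : A) :
    ⟪x, x⟫ * b * ⟪θ x, θ x⟫ = ⟪θ x, θ x⟫ * b * ⟪x, x⟫ := by
  have hsa : ∀ c : A, IsSelfAdjoint c →
      ⟪x, x⟫ * c * ⟪θ x, θ x⟫ = ⟪θ x, θ x⟫ * c * ⟪x, x⟫ := by
    intro c hc
    have hc' : IsSelfAdjoint (⟪x, x⟫ * c * ⟪x, x⟫) := by
      have := hc.conjugate ⟪x, x⟫
      rwa [star_rightInner] at this
    have h := hθ.commute_of_isSelfAdjoint hx hc' (by rw [← mul_assoc, ← mul_assoc, hx])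
    rwa [mul_assoc _ ⟪x, x⟫, hθ.self_mul_map hx, ← mul_assoc, ← mul_assoc, hθ.map_mul_self hx] at h
  rw [← realPart_add_I_smul_imaginaryPart b]
  simp only [mul_add, add_mul, mul_smul_comm, smul_mul_assoc]
  rw [hsa _ (realPart b).2, hsa _ (imaginaryPart b).2]

/-- The relation which links `⟨θ x, θ x⟩` to the values of `θ` at arbitrary vectors. -/
lemma rightInner_mul_map_self {x : E} (hx : IsPartialIsometryVector A x) (z w : E) :
    ⟪z, w⟫ * ⟪θ x, θ x⟫ = ⟪θ z, θ w⟫ * ⟪x, x⟫ := by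
  have horth : ∀ z' w' : E, ⟪x, z'⟫ = 0 → ⟪x, w'⟫ = 0 →
      ⟪z', w'⟫ * ⟪θ x, θ x⟫ = ⟪θ z', θ w'⟫ * ⟪x, x⟫ := by
    intro z' w' hz hw
    have hz' : ⟪z', x⟫ = 0 := by rw [← star_rightInner, hz, star_zero]
    have hz'' := hθ.map_orth _ _ hz'
    have hw'' := hθ.map_orth _ _ hw
    -- the coefficient of `x` is chosen so that the two contributions `± ⟪z', w'⟫ * ⟪x, x⟫` cancel
    have h : ⟪x <• ⟪w', z'⟫ + z', x - w' <• ⟪x, x⟫⟫ = 0 := by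
      simp only [rightInner_add_left, rightInner_sub_right, rightInner_smul_left,
        rightInner_smul_right, star_rightInner, hw, hz', mul_zero,
        add_zero, zero_add, sub_self]
    have h2 := hθ.map_orth _ _ h
    simp only [map_add, map_sub, hθ.map_smul, rightInner_add_left, rightInner_sub_right,
      rightInner_smul_left, rightInner_smul_right, star_rightInner, hw'', hz'', mul_zero,
      add_zero, zero_add, sub_eq_zero] at h2
    exact h2
  obtain ⟨s, hs⟩ : ∃ s, s = ⟪x, z⟫ := ⟨_, rfl⟩
  obtain ⟨t, ht⟩ : ∃ t, t = ⟪x, w⟫ := ⟨_, rfl⟩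
  have hz := hx.rightInner_sub_smul z
  have hw := hx.rightInner_sub_smul w
  have hst := horth _ _ hz hw
  have hpt : ⟪x, x⟫ * t = t := ht ▸ hx.self_mul w
  have hcomm : t * ⟪θ x, θ x⟫ = ⟪θ x, θ x⟫ * t * ⟪x, x⟫ := by
    rw [← hθ.self_mul_mul_map hx, hpt]
  have e1 : ⟪z, w⟫ = ⟪z - x <• s, w - x <• t⟫ + star s * t := by
    have hzx : ⟪z, x⟫ = star s := by rw [hs, star_rightInner]
    simp only [rightInner_sub_left, rightInner_sub_right, rightInner_smul_left,
      rightInner_smul_right, ← ht, hpt, hzx, sub_mul, mul_assoc]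
    abel
  have e2 : ⟪θ z, θ w⟫ = ⟪θ (z - x <• s), θ (w - x <• t)⟫ + star s * ⟪θ x, θ x⟫ * t := by
    have hzx : ⟪θ z, θ x⟫ = star s * ⟪θ x, θ x⟫ := by
      rw [hθ.rightInner_map_left hx, hs, star_rightInner]
    simp only [map_sub, hθ.map_smul, rightInner_sub_left, rightInner_sub_right,
      rightInner_smul_left, rightInner_smul_right, hzx, hθ.rightInner_map_right hx w, ← ht,
      sub_mul, mul_assoc]
    abel
  rw [← hs, ← ht] at hst
  rw [e1, e2, add_mul, add_mul, hst, mul_assoc, hcomm]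
  simp only [mul_assoc]

lemma map_mul_rightInner_of_isPartialIsometryVector {x : E} (hx : IsPartialIsometryVector A x)
    (y z w : E) : ⟪θ z, θ w⟫ * ⟪y, x⟫ = ⟪z, w⟫ * ⟪θ y, θ x⟫ := by
  have h := hθ.rightInner_mul_map_self hx z (w <• ⟪y, x⟫)
  rw [rightInner_smul_right, hθ.rightInner_map_smul_right, mul_assoc, mul_assoc, hx.mul_self,
    ← hθ.rightInner_map_left hx] at h
  exact h.symm

/-- An orthogonality preserving module map is automatically continuous, by the closed graph
theorem. -/
lemma continuous [CompleteSpace E] [CompleteSpace F] (hA : HasRealRankZero A)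
    (hE : IsFullHilbertModule A E) : Continuous θ := by
  refine θ.continuous_of_seq_closed_graph fun u x₀ v hu hv => ?_
  have hu' : Tendsto (fun n => u n - x₀) atTop (𝓝 0) := by
    simpa using hu.sub_const x₀
  have hv' : Tendsto (fun n => θ (u n - x₀)) atTop (𝓝 (v - θ x₀)) := by
    simpa using Tendsto.sub_const hv (θ x₀)
  have hzero : ∀ w : E, ⟪v - θ x₀, θ w⟫ = 0 := by
    intro w
    refine hE.eq_zero_of_mul fun y x => ?_
    refine hA.induction (P := fun x => ⟪v - θ x₀, θ w⟫ * ⟪y, x⟫ = 0) ?_ ?_ x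
    · exact isClosed_eq (by fun_prop) continuous_const
    · intro x b hx
      have h1 : Tendsto (fun n => ⟪θ (u n - x₀), θ w⟫ * ⟪y, x⟫) atTop
          (𝓝 (⟪v - θ x₀, θ w⟫ * ⟪y, x⟫)) :=
        (((continuous_rightInner_left A (θ w)).tendsto _).comp hv').mul_const _
      have h2 : Tendsto (fun n => ⟪u n - x₀, w⟫ * ⟪θ y, θ x⟫) atTop
          (𝓝 (⟪(0 : E), w⟫ * ⟪θ y, θ x⟫)) :=
        (((continuous_rightInner_left A w).tendsto _).comp hu').mul_const _
      simp only [hθ.map_mul_rightInner_of_isPartialIsometryVector hx] at h1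
      have h3 := tendsto_nhds_unique h1 h2
      have h0 : ⟪(0 : E), w⟫ = 0 := by simp [rightInner]
      rw [rightInner_smul_right, ← mul_assoc, h3, h0, zero_mul, zero_mul]
  -- `v - θ x₀` is orthogonal to the range of `θ` and is also a limit of vectors in that range
  have h4 : Tendsto (fun n => ⟪v - θ x₀, θ (u n - x₀)⟫) atTop (𝓝 ⟪v - θ x₀, v - θ x₀⟫) :=
    ((continuous_rightInner_right A _).tendsto _).comp hv'
  simp only [hzero] at h4
  have h5 := tendsto_nhds_unique h4 tendsto_const_nhds
  exact sub_eq_zero.1 ((rightInner_self_eq_zero _).1 h5)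

lemma map_mul_rightInner (hA : HasRealRankZero A) (hc : Continuous θ) (x y z w : E) :
    ⟪θ z, θ w⟫ * ⟪y, x⟫ = ⟪z, w⟫ * ⟪θ y, θ x⟫ := by
  refine hA.induction (P := fun x => ⟪θ z, θ w⟫ * ⟪y, x⟫ = ⟪z, w⟫ * ⟪θ y, θ x⟫) ?_ ?_ x
  · exact isClosed_eq (by fun_prop)
      (continuous_const.mul ((continuous_rightInner_right A _).comp hc))
  · intro x b hx
    rw [rightInner_smul_right, hθ.rightInner_map_smul_right, ← mul_assoc, ← mul_assoc,
      hθ.map_mul_rightInner_of_isPartialIsometryVector hx]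

end IsOrthogonalityPreserving

/-! ### The multiplier -/

lemma DoubleCentralizer.map_mul {A : Type*} [NonUnitalCStarAlgebra A] (m : 𝓜(ℂ, A)) (a b : A) :
    m.fst (a * b) = m.fst a * b := by
  have h : ∀ c, c * (m.fst (a * b) - m.fst a * b) = 0 := fun c => by
    rw [mul_sub, ← m.central, ← mul_assoc, ← mul_assoc, ← m.central, sub_self]
  rw [← sub_eq_zero, ← CStarRing.star_mul_self_eq_zero_iff]
  exact h _

lemma DoubleCentralizer.ext_fst {A : Type*} [NonUnitalCStarAlgebra A] {m n : 𝓜(ℂ, A)}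
    (h : m.fst = n.fst) : m = n := by
  rw [← sub_eq_zero, ← norm_eq_zero, ← DoubleCentralizer.norm_fst, DoubleCentralizer.sub_fst, h,
    sub_self, norm_zero]

section Graph

variable {A E F : Type*} [NonUnitalCStarAlgebra A] [PartialOrder A]
    [NormedAddCommGroup E] [NormedSpace ℂ E] [SMul Aᵐᵒᵖ E] [CStarModule Aᵐᵒᵖ E]
    [NormedAddCommGroup F] [NormedSpace ℂ F] [SMul Aᵐᵒᵖ F] [CStarModule Aᵐᵒᵖ F]
    {θ : E →ₗ[ℂ] F}

local notation "⟪" x ", " y "⟫" => rightInner A x y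

variable (A θ) in
/-- The pairs `(k, l)` for which `l` is a candidate for `u k`, where `u` is the multiplier with
`⟨θ x, θ y⟩ = u⟨x, y⟩`. It is defined by multiplying from the right by inner products, a condition
that makes sense before `u` is known to exist and is evidently closed. -/
def multiplierGraph : Submodule ℂ (A × A) where
  carrier := {k | ∀ x y : E, k.2 * ⟪x, y⟫ = k.1 * ⟪θ x, θ y⟫}
  add_mem' hk hl x y := by simp only [Prod.fst_add, Prod.snd_add, add_mul, hk x y, hl x y]
  zero_mem' x y := by simp
  smul_mem' c k hk x y := by simp only [Prod.smul_fst, Prod.smul_snd, smul_mul_assoc, hk x y]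

lemma isClosed_multiplierGraph : IsClosed (multiplierGraph A θ : Set (A × A)) := by
  have : (multiplierGraph A θ : Set (A × A))
      = ⋂ (x : E) (y : E), {k | k.2 * ⟪x, y⟫ = k.1 * ⟪θ x, θ y⟫} := by
    ext k
    simp [multiplierGraph]
  rw [this]
  exact isClosed_iInter fun x => isClosed_iInter fun y => isClosed_eq (by fun_prop) (by fun_prop)

end Graph

namespace IsOrthogonalityPreserving

variable {A E F : Type*} [NonUnitalCStarAlgebra A] [PartialOrder A] [StarOrderedRing A]
    [NormedAddCommGroup E] [NormedSpace ℂ E] [SMul Aᵐᵒᵖ E] [CStarModule Aᵐᵒᵖ E]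
    [NormedAddCommGroup F] [NormedSpace ℂ F] [SMul Aᵐᵒᵖ F] [CStarModule Aᵐᵒᵖ F]
    {θ : E →ₗ[ℂ] F} (hθ : IsOrthogonalityPreserving A θ)
include hθ

local notation "⟪" x ", " y "⟫" => rightInner A x y

/-- The key estimate: `‖l‖ ≤ M²‖k‖` on the graph. For `x : E` the defining relation gives
`⟨x l*, x l*⟩ = ⟨θ(x k*), θ(x l*)⟩`, which bounds `‖x l*‖` by `M²‖k‖‖x‖`. -/
lemma norm_snd_le (hE : IsFullHilbertModule A E) {M : ℝ} (hM0 : 0 ≤ M)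
    (hM : ∀ x, ‖θ x‖ ≤ M * ‖x‖) {k : A × A} (hk : k ∈ multiplierGraph A θ) :
    ‖k.2‖ ≤ M * M * ‖k.1‖ := by
  rw [← norm_star]
  refine hE.norm_le_of_forall_norm_rightSMul_le (by positivity) fun x => ?_
  by_cases h0 : ‖x <• star k.2‖ = 0
  · rw [h0]; positivity
  have hpos : 0 < ‖x <• star k.2‖ := lt_of_le_of_ne (norm_nonneg _) (Ne.symm h0)
  refine le_of_mul_le_mul_right ?_ hpos
  have e : ⟪x <• star k.2, x <• star k.2⟫ = ⟪θ (x <• star k.1), θ (x <• star k.2)⟫ := by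
    rw [rightInner_smul_left, star_star, hk, hθ.rightInner_map_smul_left, star_star]
  rw [← norm_rightInner_self A, e]
  calc _ ≤ ‖θ (x <• star k.1)‖ * ‖θ (x <• star k.2)‖ := norm_rightInner_le A _ _
    _ ≤ (M * ‖x <• star k.1‖) * (M * ‖x <• star k.2‖) := by gcongr <;> exact hM _
    _ ≤ (M * (‖x‖ * ‖k.1‖)) * (M * ‖x <• star k.2‖) := by
      gcongr
      rw [← norm_star k.1]
      exact norm_rightSMul_le _ _
    _ = _ := by ring

/-- The projection of the graph to the first factor is closed, by `norm_snd_le`, and dense, since it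
contains all inner products. -/
lemma exists_mem_multiplierGraph (hA : HasRealRankZero A) (hE : IsFullHilbertModule A E) {M : ℝ}
    (hM0 : 0 ≤ M) (hM : ∀ x, ‖θ x‖ ≤ M * ‖x‖) (a : A) : ∃ b, (a, b) ∈ multiplierGraph A θ := by
  have hcont : Continuous θ := (θ.mkContinuous M hM).continuous
  let f : multiplierGraph A θ →L[ℂ] A :=
    (ContinuousLinearMap.fst ℂ A A).comp (multiplierGraph A θ).subtypeL
  have hf : AntilipschitzWith (max 1 (M * M)).toNNReal f := by
    refine AddMonoidHomClass.antilipschitz_of_bound f fun k => ?_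
    rw [Real.coe_toNNReal _ (by positivity)]
    change max ‖(k : A × A).1‖ ‖(k : A × A).2‖ ≤ max 1 (M * M) * ‖(k : A × A).1‖
    refine max_le ?_ ?_
    · exact le_mul_of_one_le_left (norm_nonneg _) (le_max_left _ _)
    · exact (hθ.norm_snd_le hE hM0 hM k.2).trans (by gcongr; exact le_max_right _ _)
  have : CompleteSpace (multiplierGraph A θ) :=
    isClosed_multiplierGraph.completeSpace_coe
  have hclosed := hf.isClosed_range f.uniformContinuous
  have hsub : (Submodule.span ℂ {a : A | ∃ x y : E, ⟪x, y⟫ = a} : Set A) ⊆ Set.range f := by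
    have : Submodule.span ℂ {a : A | ∃ x y : E, ⟪x, y⟫ = a} ≤ f.range := by
      refine Submodule.span_le.2 ?_
      rintro _ ⟨z, w, rfl⟩
      exact ⟨⟨(⟪z, w⟫, ⟪θ z, θ w⟫), fun y x => hθ.map_mul_rightInner hA hcont x y z w⟩, rfl⟩
    exact this
  have ha : a ∈ Set.range f := by
    have := hE.mono hsub |>.closure_eq
    rw [hclosed.closure_eq] at this
    rw [this]
    trivial
  obtain ⟨⟨⟨k, l⟩, hk⟩, rfl⟩ := ha
  exact ⟨l, hk⟩

lemma exists_map (hA : HasRealRankZero A) (hE : IsFullHilbertModule A E) (hcont : Continuous θ) :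
    ∃ L : A →L[ℂ] A, ∀ (a : A) (x y : E), L a * ⟪x, y⟫ = a * ⟪θ x, θ y⟫ := by
  let Θ : E →L[ℂ] F := ⟨θ, hcont⟩
  have hM0 : 0 ≤ ‖Θ‖ := norm_nonneg _
  have hM : ∀ x, ‖θ x‖ ≤ ‖Θ‖ * ‖x‖ := Θ.le_opNorm
  choose f hf using hθ.exists_mem_multiplierGraph hA hE hM0 hM
  have huniq : ∀ {a b c}, (a, b) ∈ multiplierGraph A θ → (a, c) ∈ multiplierGraph A θ → b = c := by
    intro a b c hb hc
    have := hθ.norm_snd_le hE hM0 hM (sub_mem hb hc)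
    simpa [sub_eq_zero] using this
  let L : A →ₗ[ℂ] A :=
    { toFun := f
      map_add' := fun a b => huniq (hf _) (add_mem (hf a) (hf b))
      map_smul' := fun c a => huniq (hf _) ((multiplierGraph A θ).smul_mem c (hf a)) }
  exact ⟨L.mkContinuous (‖Θ‖ * ‖Θ‖) fun a => hθ.norm_snd_le hE hM0 hM (hf a), fun a => hf a⟩

lemma exists_multiplier (hA : HasRealRankZero A) (hE : IsFullHilbertModule A E)
    (hcont : Continuous θ) :
    ∃ u : 𝓜(ℂ, A), u ∈ Set.center 𝓜(ℂ, A) ∧ IsSelfAdjoint u ∧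
      ∀ x y : E, ⟪θ x, θ y⟫ = u.fst ⟪x, y⟫ := by
  obtain ⟨L, hL⟩ := hθ.exists_map hA hE hcont
  have huniq : ∀ {a b : A}, (∀ x y : E, b * ⟪x, y⟫ = a * ⟪θ x, θ y⟫) → L a = b := by
    intro a b h
    refine sub_eq_zero.1 (hE.eq_zero_of_mul fun x y => ?_)
    rw [sub_mul, hL, h, sub_self]
  have hgen : ∀ x y : E, L ⟪x, y⟫ = ⟪θ x, θ y⟫ := fun z w =>
    huniq fun y x => hθ.map_mul_rightInner hA hcont x y z w
  have hleft : ∀ a b, L (a * b) = a * L b := fun a b =>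
    huniq fun x y => by rw [mul_assoc, hL, mul_assoc]
  have hright : ∀ a b, L (a * b) = L a * b := by
    intro a b
    have := hE.eq_of_forall_rightInner
      (S := L.comp ((ContinuousLinearMap.mul ℂ A).flip b))
      (T := ((ContinuousLinearMap.mul ℂ A).flip b).comp L) fun x y => by
        simp only [ContinuousLinearMap.comp_apply, ContinuousLinearMap.flip_apply,
          ContinuousLinearMap.mul_apply']
        rw [← rightInner_smul_right, hgen, hgen, hθ.rightInner_map_smul_right]
    simpa using congrArg (fun S => S a) this
  have hstar : ∀ a, L (star a) = star (L a) := fun a => huniq fun x y => by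
    rw [← star_rightInner y x, ← star_mul, ← hleft, hright, hgen, star_mul, star_rightInner]
  let u : 𝓜(ℂ, A) := ⟨(L, L), fun x y => by rw [← hleft, hright]⟩
  have hu : u.fst = L := rfl
  have hu' : u.snd = L := rfl
  refine ⟨u, ?_, ?_, fun x y => (hgen x y).symm⟩
  · rw [Semigroup.mem_center_iff]
    intro m
    refine DoubleCentralizer.ext_fst ?_
    rw [DoubleCentralizer.mul_fst, DoubleCentralizer.mul_fst, hu]
    ext a
    have h : ∀ c, c * (m.fst (L a) - L (m.fst a)) = 0 := fun c => by
      rw [mul_sub, ← m.central, ← hleft c, ← m.central, ← hleft, sub_self]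
    exact sub_eq_zero.1 ((CStarRing.star_mul_self_eq_zero_iff _).1 (h _))
  · refine DoubleCentralizer.ext_fst ?_
    ext a
    rw [DoubleCentralizer.star_fst, hu, hu', hstar, star_star]

end IsOrthogonalityPreserving

/-! ### Positivity of the multiplier -/

section Positivity

variable {A E : Type*} [NonUnitalCStarAlgebra A] [PartialOrder A]
    [NormedAddCommGroup E] [NormedSpace ℂ E] [SMul Aᵐᵒᵖ E] [CStarModule Aᵐᵒᵖ E]

local notation "⟪" x ", " y "⟫" => rightInner A x y

/-- Multipliers are determined by their values at the elements `⟨x, x⟩`, by polarization. -/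
lemma IsFullHilbertModule.ext_multiplier (hE : IsFullHilbertModule A E) {u v : 𝓜(ℂ, A)}
    (h : ∀ x : E, u.fst ⟪x, x⟫ = v.fst ⟪x, x⟫) : u = v := by
  refine DoubleCentralizer.ext_fst (hE.eq_of_forall_rightInner fun x y => ?_)
  set D := u.fst - v.fst with hD
  have hD0 : ∀ x : E, D ⟪x, x⟫ = 0 := fun x => by simp [hD, h]
  have h1 : D ⟪x, y⟫ + D ⟪y, x⟫ = 0 := by
    have := hD0 (x + y)
    rw [rightInner_add_left, rightInner_add_right, rightInner_add_right, map_add, map_add, map_add,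
      hD0, hD0, zero_add, add_zero] at this
    exact this
  have h2 : D ⟪x, y⟫ - D ⟪y, x⟫ = 0 := by
    have := hD0 (x + Complex.I • y)
    rw [rightInner_add_left, rightInner_add_right, rightInner_add_right, map_add, map_add, map_add,
      hD0, hD0, zero_add, add_zero, rightInner_smul_right_complex, rightInner_smul_left_complex,
      map_smul, map_smul, Complex.star_def, Complex.conj_I, neg_smul, ← sub_eq_add_neg,
      ← smul_sub] at this
    exact (smul_eq_zero.1 this).resolve_left Complex.I_ne_zero
  have h3 : (2 : ℂ) • D ⟪x, y⟫ = 0 := by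
    rw [two_smul]
    calc _ = (D ⟪x, y⟫ + D ⟪y, x⟫) + (D ⟪x, y⟫ - D ⟪y, x⟫) := by abel
      _ = 0 := by rw [h1, h2, add_zero]
  have h4 := (smul_eq_zero.1 h3).resolve_left two_ne_zero
  exact sub_eq_zero.1 (by simpa [hD] using h4)

/-- Positivity of a central multiplier can be tested on the elements `⟨x, x⟩`: there, both `u` and
its absolute value give positive elements with the same square, so `u` is its absolute value. -/
lemma IsFullHilbertModule.exists_eq_star_mul_self [StarOrderedRing A]
    (hE : IsFullHilbertModule A E) {u : 𝓜(ℂ, A)}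
    (hu : u ∈ Set.center 𝓜(ℂ, A)) (hsa : IsSelfAdjoint u)
    (h : ∀ x : E, 0 ≤ u.fst ⟪x, x⟫) : ∃ v : 𝓜(ℂ, A), u = star v * v := by
  let _ : PartialOrder 𝓜(ℂ, A) := CStarAlgebra.spectralOrder _
  have _ : StarOrderedRing 𝓜(ℂ, A) := CStarAlgebra.spectralOrderedRing _
  have hcoe : ∀ a : A, 0 ≤ a → 0 ≤ (a : 𝓜(ℂ, A)) := fun a ha => by
    obtain ⟨b, rfl⟩ := CStarAlgebra.nonneg_iff_eq_star_mul_self.1 ha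
    have : ((star b * b : A) : 𝓜(ℂ, A)) = star (b : 𝓜(ℂ, A)) * (b : 𝓜(ℂ, A)) := by
      have hs : ((star b : A) : 𝓜(ℂ, A)) = star (b : 𝓜(ℂ, A)) :=
        map_star (DoubleCentralizer.coeHom (𝕜 := ℂ) (A := A)) b
      rw [← hs]
      exact map_mul (DoubleCentralizer.coeHom (𝕜 := ℂ) (A := A)) _ _
    rw [this]
    exact star_mul_self_nonneg _
  have hmulcoe : ∀ (w : 𝓜(ℂ, A)) (a : A), w * (a : 𝓜(ℂ, A)) = ((w.fst a : A) : 𝓜(ℂ, A)) := by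
    intro w a
    refine DoubleCentralizer.ext_fst ?_
    ext b
    simp [DoubleCentralizer.map_mul]
  have hcomm : ∀ m, Commute u m := fun m => ((Semigroup.mem_center_iff.1 hu) m).symm
  obtain ⟨v, hv⟩ : ∃ v, v = cfc (fun t : ℝ => |t|) u := ⟨_, rfl⟩
  have hv0 : 0 ≤ v := hv ▸ cfc_nonneg fun t _ => abs_nonneg t
  have hvcomm : ∀ m, Commute v m := fun m => hv ▸ (hcomm m).cfc_real _
  have hvv : v * v = u * u := by
    rw [hv, ← cfc_mul _ _ u]
    conv_rhs => rw [← cfc_id' ℝ u, ← cfc_mul _ _ u]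
    exact cfc_congr fun t _ => abs_mul_abs_self t
  have huv : u = v := by
    refine hE.ext_multiplier fun x => ?_
    have hk := hcoe _ (rightInner_self_nonneg x)
    have h1 : 0 ≤ u * (⟪x, x⟫ : 𝓜(ℂ, A)) := by
      rw [hmulcoe]
      exact hcoe _ (h x)
    have h2 : 0 ≤ v * (⟪x, x⟫ : 𝓜(ℂ, A)) := Commute.mul_nonneg hv0 hk (hvcomm _)
    have h3 : u * (⟪x, x⟫ : 𝓜(ℂ, A)) = v * (⟪x, x⟫ : 𝓜(ℂ, A)) := by
      rw [← CFC.mul_self_eq_mul_self_iff _ _ h1 h2, (hcomm _).symm.mul_mul_mul_comm,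
        (hvcomm _).symm.mul_mul_mul_comm, hvv]
    rw [hmulcoe, hmulcoe] at h3
    have h4 : ∀ c, (u.fst ⟪x, x⟫ - v.fst ⟪x, x⟫) * c = 0 := fun c => by
      have := congrArg (fun m : 𝓜(ℂ, A) => m.fst c) h3
      rw [sub_mul, sub_eq_zero]
      simpa using this
    exact sub_eq_zero.1 ((CStarRing.mul_star_self_eq_zero_iff _).1 (h4 _))
  exact CStarAlgebra.nonneg_iff_eq_star_mul_self.1 (huv ▸ hv0)

end Positivity

theorem theorem2p3 {A E F : Type*}
    [NonUnitalCStarAlgebra A] [PartialOrder A] [StarOrderedRing A]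
    [NormedAddCommGroup E] [NormedSpace ℂ E] [SMul Aᵐᵒᵖ E] [CStarModule Aᵐᵒᵖ E] [CompleteSpace E]
    [NormedAddCommGroup F] [NormedSpace ℂ F] [SMul Aᵐᵒᵖ F] [CStarModule Aᵐᵒᵖ F] [CompleteSpace F]
    (hA : HasRealRankZero A) (hE : IsFullHilbertModule A E)
    (θ : E →ₗ[ℂ] F)
    (hθ_module : ∀ (x : E) (a : A), θ (x <• a) = θ x <• a)
    (hθ_orth : ∀ x y : E, rightInner A x y = 0 → rightInner A (θ x) (θ y) = 0) :
    (∃ u : 𝓜(ℂ, A), IsCentralPositiveMultiplier u ∧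
      ∀ x y : E, rightInner A (θ x) (θ y) = u.fst (rightInner A x y)) ∧
    ∃ C : ℝ, ∀ x : E, ‖θ x‖ ≤ C * ‖x‖ := by
  have hθ : IsOrthogonalityPreserving A θ := ⟨hθ_module, hθ_orth⟩
  have hcont := hθ.continuous hA hE
  obtain ⟨u, hu, hsa, huθ⟩ := hθ.exists_multiplier hA hE hcont
  refine ⟨⟨u, ⟨hu, ?_⟩, huθ⟩, ‖(⟨θ, hcont⟩ : E →L[ℂ] F)‖,
    (⟨θ, hcont⟩ : E →L[ℂ] F).le_opNorm⟩
  exact hE.exists_eq_star_mul_self hu hsa fun x => huθ x x ▸ rightInner_self_nonneg (θ x)
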